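/- Let $n\ge 1$ be an integer, let $\mathbb N^\times$ be the multiplicative monoid of positive integers, and let $P=\mathbb N^\times\ltimes\mathbb Z/n\mathbb Z$ be the set $\mathbb N^\times\times\mathbb Z/n\mathbb Z$ with the product $$(a,[k])\cdot(b,[l])=(ab,[kb+l]).$$ For a left cancellative monoid $P$, let $\mathcal I_l$ be its left inverse hull, i.e. the inverse semigroup of partial bijections of $P$ generated by the left multiplications $P\to cP$, $x\mapsto cx$ ($c\in P$). Let $E$ be its semilattice of idempotents, identified with a family of subsets of $P$. Let $\Omega$ be the space of nonzero semicharacters $\chi:E\to\{0,1\}$ that satisfy $\chi(f)=\bigvee_i\chi(e_i)$ whenever $f,e_i\in E$ and $f=\bigcup_i e_i$ is a finite union (the empty union included), with the topology of pointwise convergence. Let $\overline E$ be the family of the sets $\bigcup_{i}\bigl(e_i\setminus\bigcup_j f_{ij}\bigr)$ (finite unions, $e_i,f_{ij}\in E$, $f_{ij}\subseteq e_i$), to which each $\chi\in\Omega$ extends by $\chi\bigl(\bigcup_{i}(e_i\setminus\bigcup_j f_{ij})\bigr)=\bigvee_{i}\bigl(\chi(e_i)\setminus\bigvee_j\chi(f_{ij})\bigr)$,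 and let $\overline{\mathcal I}_l=\{se: s\in\mathcal I_l,\ e\in\overline E,\ e\le s^{-1}s\}$. An element $s\in\overline{\mathcal I}_l$ acts on the $\chi\in\Omega$ with $\chi(s^{-1}s)=1$ by $(s\cdot\chi)(e)=\chi(s^{-1}es)$. The associated groupoid $\mathcal G=\overline{\mathcal I}_l\ltimes\Omega$ is the set of equivalence classes $[s,\chi]$ of pairs $(s,\chi)\in\overline{\mathcal I}_l\times\Omega$ with $\chi(s^{-1}s)=1$, where $(s,\chi)\sim(t,\psi)$ if and only if $\chi=\psi$ and $se=te$ for some $e\in\overline E$ with $\chi(e)=1$; the source of $[s,\chi]$ is $\chi$, its target is $s\cdot\chi$, its inverse is $[s^{-1},s\cdot\chi]$, and $[s,t\cdot\chi][t,\chi]=[st,\chi]$. It carries the topology with basis the sets $\{[s,\chi]:\chi\in U\}$, where $s\in\overline{\mathcal I}_l$ and $U\subseteq\{\chi\in\Omega:\chi(s^{-1}s)=1\}$ is open in $\Omega$. Then: 1. $P=\mathbb N^\times\ltimes\mathbb Z/n\mathbb Z$ is left cancellative. 2. If $n\ge2$, then $P$ is not right cancellative, and hence it does not embed in a group. 3.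 For all $a,b\in\mathbb N^\times$ and $k,l\in\mathbb Z$, $$(a,[k])P\cap(b,[l])P=(\operatorname{lcm}(a,b),[0])P ,$$ so $P$ is right LCM (it is left cancellative, and the intersection of any two principal right ideals is empty or a principal right ideal). 4. The groupoid $\mathcal G$ associated to $P$ is Hausdorff and second-countable. -/

import Mathlib

noncomputable section

namespace MonoidGpd

open Set Classical

/-! ### Partial bijections -/

section Partial

variable {P : Type}

/-- The domain of a partial bijection. -/
def dom (s : P ≃. P) : Set P := {x | ∃ y, y ∈ s x}

/-- The set of points that a partial bijection `s` is defined at and maps into `X`.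
If `e` is the partial identity on `X`, this is the domain of the idempotent `s⁻¹ e s`. -/
def pre (s : P ≃. P) (X : Set P) : Set P := {x | ∃ y, y ∈ s x ∧ y ∈ X}

/-- The partial identity on a set. -/
def idOn (X : Set P) : P ≃. P := PEquiv.ofSet X

/-- The restriction `s e`, for `e` the partial identity on `X`. -/
def restr (s : P ≃. P) (X : Set P) : P ≃. P := (idOn X).trans s

theorem mem_idOn {X : Set P} {x y : P} : y ∈ idOn X x ↔ y = x ∧ y ∈ X := by
  simp [idOn]

theorem mem_restr {s : P ≃. P} {X : Set P} {x y : P} : y ∈ restr s X x ↔ x ∈ X ∧ y ∈ s x := by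
  unfold restr
  rw [PEquiv.mem_trans]
  constructor
  · rintro ⟨b, hb, h⟩
    obtain ⟨rfl, hb'⟩ := mem_idOn.1 hb
    exact ⟨hb', h⟩
  · rintro ⟨hx, h⟩
    exact ⟨x, mem_idOn.2 ⟨rfl, hx⟩, h⟩

theorem pequiv_ext {s t : P ≃. P} (h : ∀ x y, y ∈ s x ↔ y ∈ t x) : s = t :=
  PEquiv.ext fun x => Option.ext fun y => h x y

theorem mem_uniq {s : P ≃. P} {x y z : P} (h : y ∈ s x) (h' : z ∈ s x) : y = z :=
  Option.mem_unique h h'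

theorem dom_eq_pre_univ (s : P ≃. P) : dom s = pre s univ := by
  ext x; simp [dom, pre]

theorem pre_inter (s : P ≃. P) (X Y : Set P) : pre s (X ∩ Y) = pre s X ∩ pre s Y := by
  ext x
  constructor
  · rintro ⟨y, hy, h1, h2⟩
    exact ⟨⟨y, hy, h1⟩, ⟨y, hy, h2⟩⟩
  · rintro ⟨⟨y, hy, h1⟩, ⟨z, hz, h2⟩⟩
    obtain rfl := mem_uniq hy hz
    exact ⟨y, hy, h1, h2⟩

theorem pre_diff (s : P ≃. P) (X Y : Set P) : pre s (X \ Y) = pre s X \ pre s Y := by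
  ext x
  constructor
  · rintro ⟨y, hy, h1, h2⟩
    refine ⟨⟨y, hy, h1⟩, ?_⟩
    rintro ⟨z, hz, h3⟩
    obtain rfl := mem_uniq hy hz
    exact h2 h3
  · rintro ⟨⟨y, hy, h1⟩, h⟩
    exact ⟨y, hy, h1, fun h2 => h ⟨y, hy, h2⟩⟩

theorem pre_mono (s : P ≃. P) {X Y : Set P} (h : X ⊆ Y) : pre s X ⊆ pre s Y := by
  rintro x ⟨y, hy, h1⟩
  exact ⟨y, hy, h h1⟩

theorem pre_subset_dom (s : P ≃. P) (X : Set P) : pre s X ⊆ dom s := by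
  rintro x ⟨y, hy, _⟩
  exact ⟨y, hy⟩

theorem pre_biUnion {ι : Type} (s : P ≃. P) (S : Finset ι) (X : ι → Set P) :
    pre s (⋃ i ∈ S, X i) = ⋃ i ∈ S, pre s (X i) := by
  ext x
  simp only [pre, mem_ofPred_eq, mem_iUnion]
  constructor
  · rintro ⟨y, hy, i, hi, h⟩
    exact ⟨i, hi, y, hy, h⟩
  · rintro ⟨i, hi, y, hy, h⟩
    exact ⟨y, hy, i, hi, h⟩

theorem pre_trans (s t : P ≃. P) (X : Set P) : pre (t.trans s) X = pre t (pre s X) := by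
  ext x
  simp only [pre, mem_ofPred_eq, PEquiv.mem_trans]
  constructor
  · rintro ⟨y, ⟨b, hb, hy⟩, h⟩
    exact ⟨b, hb, y, hy, h⟩
  · rintro ⟨b, hb, y, hy, h⟩
    exact ⟨y, ⟨b, hb, hy⟩, h⟩

theorem pre_restr (s : P ≃. P) (X Y : Set P) : pre (restr s X) Y = X ∩ pre s Y := by
  ext x
  simp only [pre, mem_ofPred_eq, mem_restr, mem_inter_iff]
  constructor
  · rintro ⟨y, ⟨h1, h2⟩, h3⟩
    exact ⟨h1, y, h2, h3⟩
  · rintro ⟨h1, y, h2, h3⟩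
    exact ⟨y, ⟨h1, h2⟩, h3⟩

theorem pre_idOn (X Y : Set P) : pre (idOn X) Y = X ∩ Y := by
  ext x
  simp only [pre, mem_ofPred_eq, mem_idOn, mem_inter_iff]
  constructor
  · rintro ⟨y, ⟨rfl, h1⟩, h2⟩
    exact ⟨h1, h2⟩
  · rintro ⟨h1, h2⟩
    exact ⟨x, ⟨rfl, h1⟩, h2⟩

theorem dom_idOn (X : Set P) : dom (idOn X) = X := by
  rw [dom_eq_pre_univ, pre_idOn, inter_univ]

theorem pre_symm_pre (s : P ≃. P) (X : Set P) : pre s (pre s.symm X) = dom s ∩ X := by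
  ext x
  constructor
  · rintro ⟨y, hy, z, hz, h⟩
    have hz' : y ∈ s z := (PEquiv.mem_iff_mem s).1 hz
    obtain rfl := PEquiv.inj s hy hz'
    exact ⟨⟨y, hy⟩, h⟩
  · rintro ⟨⟨y, hy⟩, h⟩
    exact ⟨y, hy, x, (PEquiv.mem_iff_mem s).2 hy, h⟩

theorem restr_eq_iff {s t : P ≃. P} {X : Set P} :
    restr s X = restr t X ↔ ∀ x ∈ X, ∀ y, y ∈ s x ↔ y ∈ t x := by
  constructor
  · intro h x hx y
    have : y ∈ restr s X x ↔ y ∈ restr t X x := by rw [h]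
    rw [mem_restr, mem_restr] at this
    exact (and_congr_right_iff.1 this) hx
  · intro h
    refine pequiv_ext fun x y => ?_
    rw [mem_restr, mem_restr]
    exact and_congr_right fun hx => h x hx y

end Partial

variable (P : Type) [Monoid P] [IsLeftCancelMul P]

/-! ### The left inverse hull and its idempotents -/

variable {P} in
/-- Left multiplication by `c`, as a partial bijection from `P` onto `c P`. -/
def leftMul (c : P) : P ≃. P where
  toFun x := some (c * x)
  invFun y := if h : ∃ x, c * x = y then some h.choose else none
  inv x y := by
    constructor
    · intro h
      split_ifs at h with hy
      have h1 := hy.choose_spec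
      rw [Option.some.inj h] at h1
      rw [h1]
    · intro h
      have h1 : c * x = y := Option.some.inj h
      have hy : ∃ x, c * x = y := ⟨x, h1⟩
      rw [dif_pos hy]
      congr 1
      exact mul_left_cancel (hy.choose_spec.trans h1.symm)

/-- The left inverse hull: the smallest set of partial bijections of `P` that contains the left
multiplications and is closed under composition and inversion. -/
inductive LeftHull : (P ≃. P) → Prop
  | leftMul (c : P) : LeftHull (leftMul c)
  | comp {s t : P ≃. P} : LeftHull s → LeftHull t → LeftHull (t.trans s)
  | inv {s : P ≃. P} : LeftHull s → LeftHull s.symm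

/-- The semilattice of idempotents of the left inverse hull. An idempotent is the partial identity
on a subset of `P`, and it is identified with this subset. -/
structure Idem : Type where
  carrier : Set P
  mem_hull : LeftHull P (idOn carrier)

variable {P}

instance : CoeOut (Idem P) (Set P) := ⟨Idem.carrier⟩

theorem Idem.ext {e f : Idem P} (h : (e : Set P) = f) : e = f := by
  cases e; cases f; cases h; rfl

theorem LeftHull.refl : LeftHull P (PEquiv.refl P) := by
  have h := LeftHull.leftMul (1 : P)
  have : MonoidGpd.leftMul (1 : P) = PEquiv.refl P := by
    apply PEquiv.ext
    intro x
    change some ((1 : P) * x) = some x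
    rw [one_mul]
  rwa [this] at h

/-- The identity, as an idempotent. -/
def Idem.top : Idem P := ⟨univ, by
  have : idOn (univ : Set P) = PEquiv.refl P :=
    pequiv_ext fun x y => by rw [mem_idOn]; simp [eq_comm]
  rw [this]; exact LeftHull.refl⟩

/-- The product of two idempotents. -/
def Idem.inter (e f : Idem P) : Idem P := ⟨(e : Set P) ∩ f, by
  have : idOn ((e : Set P) ∩ f) = (idOn (f : Set P)).trans (idOn (e : Set P)) :=
    pequiv_ext fun x y => by
      change _ ↔ y ∈ restr (idOn (e : Set P)) (f : Set P) x
      rw [mem_restr, mem_idOn, mem_idOn]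
      constructor
      · rintro ⟨rfl, h1, h2⟩
        exact ⟨h2, rfl, h1⟩
      · rintro ⟨h2, rfl, h1⟩
        exact ⟨rfl, h1, h2⟩
  rw [this]; exact LeftHull.comp e.mem_hull f.mem_hull⟩

/-- The idempotent `s⁻¹ e s`, for `s` in the left inverse hull. -/
def Idem.pre {s : P ≃. P} (hs : LeftHull P s) (e : Idem P) : Idem P :=
  ⟨MonoidGpd.pre s (e : Set P), by
  have : idOn (MonoidGpd.pre s (e : Set P)) = s.trans ((idOn (e : Set P)).trans s.symm) :=
    pequiv_ext fun x y => by
      rw [mem_idOn, PEquiv.mem_trans]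
      constructor
      · rintro ⟨rfl, z, hz, h⟩
        exact ⟨z, hz, mem_restr.2 ⟨h, (PEquiv.mem_iff_mem s).2 hz⟩⟩
      · rintro ⟨z, hz, h⟩
        obtain ⟨h1, h2⟩ := (mem_restr (s := s.symm)).1 h
        have h3 : z ∈ s y := (PEquiv.mem_iff_mem s).1 h2
        exact ⟨PEquiv.inj s h3 hz, z, h3, h1⟩
  rw [this]; exact LeftHull.comp (LeftHull.comp (LeftHull.inv hs) e.mem_hull) hs⟩

/-! ### The spectrum -/

variable (P) in
/-- The space of nonzero semicharacters `χ` of the semilattice of idempotents such that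
`χ f = ⋁ χ eᵢ` for all idempotents with `f = ⋁ eᵢ`, a finite supremum of sets (the empty
supremum included, so that `χ 0 = 0` if the empty map belongs to the left inverse hull). -/
structure Spectrum : Type where
  toFun : Idem P → Bool
  nonzero : ∃ e, toFun e = true
  map_inter : ∀ e f, toFun (e.inter f) = (toFun e && toFun f)
  map_sup : ∀ (f : Idem P) (F : Finset (Idem P)),
    (f : Set P) = ⋃ e ∈ F, (e : Set P) → toFun f = F.sup toFun

instance : CoeFun (Spectrum P) (fun _ => Idem P → Bool) := ⟨Spectrum.toFun⟩

/-- The topology of pointwise convergence. -/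
instance : TopologicalSpace (Spectrum P) :=
  TopologicalSpace.induced Spectrum.toFun inferInstance

/-! ### The boolean closure of the semilattice of idempotents -/

/-- A finite family of pairs `(eᵢ, {fᵢⱼ}ⱼ)` of an idempotent and a finite set of idempotents below
it. It stands for the expression `⋁ᵢ (eᵢ \ ⋁ⱼ fᵢⱼ)`. -/
def IsExpr (S : Finset (Idem P × Finset (Idem P))) : Prop :=
  ∀ p ∈ S, ∀ f ∈ p.2, (f : Set P) ⊆ p.1

/-- The set `⋃ᵢ (eᵢ \ ⋃ⱼ fᵢⱼ)`. -/
def exprSet (S : Finset (Idem P × Finset (Idem P))) : Set P :=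
  ⋃ p ∈ S, ((p.1 : Set P) \ ⋃ f ∈ p.2, (f : Set P))

/-- The truth value `⋁ᵢ (χ eᵢ \ ⋁ⱼ χ fᵢⱼ)`. -/
def exprVal (χ : Idem P → Bool) (S : Finset (Idem P × Finset (Idem P))) : Prop :=
  ∃ p ∈ S, χ p.1 = true ∧ ∀ f ∈ p.2, χ f = false

variable (P) in
/-- The boolean closure of the semilattice of idempotents. -/
def boolClosure : Set (Set P) := {X | ∃ S, IsExpr S ∧ exprSet S = X}

/-- The extension of `χ` to the boolean closure: `Ext χ X` says that the extension takes the
value `1` at `X`. By `ext_iff_of_isExpr` below, the choice of the expression for `X` is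
irrelevant. -/
def Ext (χ : Spectrum P) (X : Set P) : Prop :=
  ∃ S, IsExpr S ∧ exprSet S = X ∧ exprVal χ S

variable (P) in
/-- The enlarged left inverse hull: all `s e` with `s` in the left inverse hull and `e` in the
boolean closure, `e ≤ s⁻¹ s`. -/
def hull : Set (P ≃. P) :=
  {r | ∃ s X, LeftHull P s ∧ X ∈ boolClosure P ∧ X ⊆ dom s ∧ r = restr s X}

/-! Closure properties of the boolean closure. -/

theorem bool_union {X Y : Set P} (hX : X ∈ boolClosure P) (hY : Y ∈ boolClosure P) :
    X ∪ Y ∈ boolClosure P := by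
  obtain ⟨S, hS, rfl⟩ := hX
  obtain ⟨T, hT, rfl⟩ := hY
  refine ⟨S ∪ T, ?_, ?_⟩
  · intro p hp
    rcases Finset.mem_union.1 hp with h | h
    · exact hS p h
    · exact hT p h
  · exact Finset.set_biUnion_union _ _ _

theorem bool_biUnion {ι : Type} (S : Finset ι) (X : ι → Set P)
    (h : ∀ i ∈ S, X i ∈ boolClosure P) : (⋃ i ∈ S, X i) ∈ boolClosure P := by
  induction S using Finset.induction_on with
  | empty => exact ⟨∅, by simp [IsExpr], by simp [exprSet]⟩
  | insert a S ha ih =>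
    rw [Finset.set_biUnion_insert]
    exact bool_union (h a (Finset.mem_insert_self _ _))
      (ih fun i hi => h i (Finset.mem_insert_of_mem hi))

theorem bool_piece (e : Idem P) (F : Finset (Idem P)) :
    (e : Set P) \ (⋃ f ∈ F, (f : Set P)) ∈ boolClosure P := by
  refine ⟨{(e, F.image fun f => e.inter f)}, ?_, ?_⟩
  · intro p hp f hf
    obtain rfl := Finset.mem_singleton.1 hp
    obtain ⟨g, _, rfl⟩ := Finset.mem_image.1 hf
    exact inter_subset_left
  · ext x
    simp only [exprSet, Finset.mem_singleton, iUnion_iUnion_eq_left, Finset.mem_image,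
      iUnion_exists, biUnion_and', iUnion_iUnion_eq_right, mem_sdiff, mem_iUnion, not_exists]
    constructor
    · rintro ⟨h1, h2⟩
      exact ⟨h1, fun f hf hx => h2 f hf ⟨h1, hx⟩⟩
    · rintro ⟨h1, h2⟩
      exact ⟨h1, fun f hf hx => h2 f hf hx.2⟩

theorem bool_idem (e : Idem P) : (e : Set P) ∈ boolClosure P := by
  have := bool_piece e ∅
  simpa using this

theorem bool_inter {X Y : Set P} (hX : X ∈ boolClosure P) (hY : Y ∈ boolClosure P) :
    X ∩ Y ∈ boolClosure P := by
  obtain ⟨S, hS, rfl⟩ := hX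
  obtain ⟨T, hT, rfl⟩ := hY
  have : exprSet S ∩ exprSet T = ⋃ p ∈ S, ⋃ q ∈ T,
      ((p.1.inter q.1 : Idem P) : Set P) \ ⋃ f ∈ p.2 ∪ q.2, (f : Set P) := by
    ext x
    simp only [exprSet, Finset.set_biUnion_union, mem_inter_iff, mem_iUnion, exists_prop]
    constructor
    · rintro ⟨⟨p, hp, h1, h2⟩, ⟨q, hq, h3, h4⟩⟩
      exact ⟨p, hp, q, hq, ⟨h1, h3⟩, fun h => h.elim h2 h4⟩
    · rintro ⟨p, hp, q, hq, ⟨h1, h3⟩, h⟩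
      exact ⟨⟨p, hp, h1, fun h' => h (Or.inl h')⟩, ⟨q, hq, h3, fun h' => h (Or.inr h')⟩⟩
  rw [this]
  exact bool_biUnion _ _ fun p _ => bool_biUnion _ _ fun q _ => bool_piece _ _

theorem bool_pre {s : P ≃. P} (hs : LeftHull P s) {X : Set P} (hX : X ∈ boolClosure P) :
    pre s X ∈ boolClosure P := by
  obtain ⟨S, hS, rfl⟩ := hX
  unfold exprSet
  rw [pre_biUnion]
  refine bool_biUnion _ _ fun p _ => ?_
  rw [pre_diff, pre_biUnion]
  have := bool_piece (Idem.pre hs p.1) (p.2.image (Idem.pre hs))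
  rwa [Finset.set_biUnion_finset_image] at this

theorem hull_pre {s : P ≃. P} (hs : s ∈ hull P) {X : Set P} (hX : X ∈ boolClosure P) :
    pre s X ∈ boolClosure P := by
  obtain ⟨t, Y, ht, hY, _, rfl⟩ := hs
  rw [pre_restr]
  exact bool_inter hY (bool_pre ht hX)

theorem bool_univ : (univ : Set P) ∈ boolClosure P := bool_idem Idem.top

theorem hull_dom {s : P ≃. P} (hs : s ∈ hull P) : dom s ∈ boolClosure P := by
  rw [dom_eq_pre_univ]
  exact hull_pre hs bool_univ

theorem hull_comp {s t : P ≃. P} (hs : s ∈ hull P) (ht : t ∈ hull P) : t.trans s ∈ hull P := by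
  obtain ⟨s', Y, hs', hY, hYs, rfl⟩ := hs
  obtain ⟨t', X, ht', hX, hXt, rfl⟩ := ht
  refine ⟨t'.trans s', X ∩ pre t' Y, LeftHull.comp hs' ht', bool_inter hX (bool_pre ht' hY),
    ?_, ?_⟩
  · rintro x ⟨_, y, hy, hyY⟩
    obtain ⟨z, hz⟩ := hYs hyY
    exact ⟨z, (PEquiv.mem_trans _ _ _ _).2 ⟨y, hy, hz⟩⟩
  · refine pequiv_ext fun x y => ?_
    rw [PEquiv.mem_trans, mem_restr, PEquiv.mem_trans]
    simp only [mem_restr]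
    constructor
    · rintro ⟨b, ⟨h1, h2⟩, h3, h4⟩
      exact ⟨⟨h1, b, h2, h3⟩, b, h2, h4⟩
    · rintro ⟨⟨h1, c, h2, h3⟩, b, h4, h5⟩
      obtain rfl := mem_uniq h2 h4
      exact ⟨c, ⟨h1, h2⟩, h3, h5⟩

theorem hull_inv {s : P ≃. P} (hs : s ∈ hull P) : s.symm ∈ hull P := by
  obtain ⟨t, X, ht, hX, hXt, rfl⟩ := hs
  refine ⟨t.symm, pre t.symm X, LeftHull.inv ht, bool_pre (LeftHull.inv ht) hX,
    pre_subset_dom _ _, ?_⟩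
  refine pequiv_ext fun x y => ?_
  rw [PEquiv.mem_iff_mem, mem_restr, mem_restr]
  constructor
  · rintro ⟨h1, h2⟩
    exact ⟨⟨y, (PEquiv.mem_iff_mem t).2 h2, h1⟩, (PEquiv.mem_iff_mem t).2 h2⟩
  · rintro ⟨⟨z, hz, h1⟩, h2⟩
    obtain rfl := mem_uniq hz h2
    exact ⟨h1, (PEquiv.mem_iff_mem t).1 h2⟩

theorem hull_idOn {X : Set P} (hX : X ∈ boolClosure P) : idOn X ∈ hull P := by
  refine ⟨PEquiv.refl P, X, LeftHull.refl, hX, fun x _ => ⟨x, rfl⟩, ?_⟩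
  unfold restr
  rw [PEquiv.trans_refl]

/-! ### The extension of a character to the boolean closure -/

theorem spec_top (χ : Spectrum P) : χ Idem.top = true := by
  obtain ⟨e, he⟩ := χ.nonzero
  have h := χ.map_inter e Idem.top
  have h' : e.inter Idem.top = e := Idem.ext (inter_univ _)
  rw [h', he] at h
  simpa using h.symm

theorem spec_inter (χ : Spectrum P) (e f : Idem P) :
    χ (e.inter f) = true ↔ χ e = true ∧ χ f = true := by
  rw [χ.map_inter]; simp

theorem spec_join (χ : Spectrum P) (f : Idem P) (F : Finset (Idem P))
    (h : (f : Set P) = ⋃ e ∈ F, (e : Set P)) : χ f = true ↔ ∃ e ∈ F, χ e = true := by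
  rw [χ.map_sup f F h]
  clear h
  induction F using Finset.induction_on with
  | empty => simp
  | insert a F ha ih => rw [Finset.sup_insert]; simp [ih]

theorem spec_cover (χ : Spectrum P) (f : Idem P) (F : Finset (Idem P)) (hf : χ f = true)
    (h : (f : Set P) ⊆ ⋃ e ∈ F, (e : Set P)) : ∃ e ∈ F, χ e = true := by
  have h1 : (f : Set P) = ⋃ e ∈ F.image fun e => f.inter e, (e : Set P) := by
    rw [Finset.set_biUnion_finset_image]
    change _ = ⋃ e ∈ F, (f : Set P) ∩ (e : Set P)
    rw [← inter_iUnion₂]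
    exact (inter_eq_left.2 h).symm
  obtain ⟨e, he, h2⟩ := (spec_join χ f _ h1).1 hf
  obtain ⟨g, hg, rfl⟩ := Finset.mem_image.1 he
  exact ⟨g, hg, ((spec_inter χ f g).1 h2).2⟩

/-- The filter on `P` generated by the sets on which a character is `1` and the complements of the
sets on which it is `0`. -/
def filt (χ : Spectrum P) : Filter P where
  sets := {X | ∃ (e : Idem P) (F : Finset (Idem P)), χ e = true ∧ (∀ f ∈ F, χ f = false) ∧
    (e : Set P) \ (⋃ f ∈ F, (f : Set P)) ⊆ X}
  univ_sets := ⟨Idem.top, ∅, spec_top χ, by simp, subset_univ _⟩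
  sets_of_superset := by
    rintro X Y ⟨e, F, h1, h2, h3⟩ h
    exact ⟨e, F, h1, h2, h3.trans h⟩
  inter_sets := by
    rintro X Y ⟨e, F, h1, h2, h3⟩ ⟨e', F', h1', h2', h3'⟩
    refine ⟨e.inter e', F ∪ F', (spec_inter χ e e').2 ⟨h1, h1'⟩, ?_, ?_⟩
    · intro f hf
      rcases Finset.mem_union.1 hf with h | h
      · exact h2 f h
      · exact h2' f h
    · rw [Finset.set_biUnion_union]
      rintro x ⟨⟨hx, hx'⟩, hn⟩
      exact ⟨h3 ⟨hx, fun h => hn (Or.inl h)⟩, h3' ⟨hx', fun h => hn (Or.inr h)⟩⟩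

theorem mem_filt {χ : Spectrum P} {X : Set P} : X ∈ filt χ ↔
    ∃ (e : Idem P) (F : Finset (Idem P)), χ e = true ∧ (∀ f ∈ F, χ f = false) ∧
      (e : Set P) \ (⋃ f ∈ F, (f : Set P)) ⊆ X := Iff.rfl

theorem empty_notMem_filt (χ : Spectrum P) : (∅ : Set P) ∉ filt χ := by
  rintro ⟨e, F, h1, h2, h3⟩
  obtain ⟨f, hf, h4⟩ := spec_cover χ e F h1 (sdiff_eq_empty.1 (subset_empty_iff.1 h3))
  rw [h2 f hf] at h4
  exact Bool.false_ne_true h4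

theorem idem_mem_filt {χ : Spectrum P} {e : Idem P} : (e : Set P) ∈ filt χ ↔ χ e = true := by
  constructor
  · intro h
    by_contra hn
    have hn : χ e = false := by simpa using hn
    have h2 : (e : Set P)ᶜ ∈ filt χ :=
      ⟨Idem.top, {e}, spec_top χ, by simpa using hn, by
        rintro x ⟨_, hx⟩
        simpa using hx⟩
    have := Filter.inter_mem h h2
    rw [inter_compl_self] at this
    exact empty_notMem_filt χ this
  · intro h
    exact ⟨e, ∅, h, by simp, sdiff_subset⟩

theorem compl_idem_mem_filt {χ : Spectrum P} {e : Idem P} (h : χ e = false) :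
    (e : Set P)ᶜ ∈ filt χ :=
  ⟨Idem.top, {e}, spec_top χ, by simpa using h, by
    rintro x ⟨_, hx⟩
    simpa using hx⟩

theorem exprVal_mem_filt {χ : Spectrum P} {S : Finset (Idem P × Finset (Idem P))}
    (h : exprVal χ S) : exprSet S ∈ filt χ := by
  obtain ⟨p, hp, h1, h2⟩ := h
  exact ⟨p.1, p.2, h1, h2, subset_biUnion_of_mem (s := (S : Set _))
    (u := fun p : Idem P × Finset (Idem P) => (p.1 : Set P) \ ⋃ f ∈ p.2, (f : Set P)) hp⟩

theorem compl_mem_filt {χ : Spectrum P} {S : Finset (Idem P × Finset (Idem P))}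
    (h : ¬ exprVal χ S) : (exprSet S)ᶜ ∈ filt χ := by
  unfold exprSet
  rw [compl_iUnion₂]
  refine (Filter.biInter_finset_mem S).2 fun p hp => ?_
  by_cases h1 : χ p.1 = true
  · have : ∃ f ∈ p.2, χ f = true := by
      by_contra hc
      push Not at hc
      exact h ⟨p, hp, h1, fun f hf => by simpa using hc f hf⟩
    obtain ⟨f, hf, h2⟩ := this
    refine Filter.mem_of_superset (idem_mem_filt.2 h2) ?_
    rintro x hx ⟨_, h3⟩
    exact h3 (mem_biUnion (s := (p.2 : Set _)) hf hx)
  · have h1 : χ p.1 = false := by simpa using h1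
    refine Filter.mem_of_superset (compl_idem_mem_filt h1) ?_
    rintro x hx ⟨h2, _⟩
    exact hx h2

theorem ext_iff {χ : Spectrum P} {X : Set P} : Ext χ X ↔ X ∈ boolClosure P ∧ X ∈ filt χ := by
  constructor
  · rintro ⟨S, h1, rfl, h2⟩
    exact ⟨⟨S, h1, rfl⟩, exprVal_mem_filt h2⟩
  · rintro ⟨⟨S, h1, rfl⟩, h2⟩
    refine ⟨S, h1, rfl, ?_⟩
    by_contra hn
    have := Filter.inter_mem h2 (compl_mem_filt hn)
    rw [inter_compl_self] at this
    exact empty_notMem_filt χ this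

/-- The extension of a character to the boolean closure does not depend on the choice of an
expression. -/
theorem ext_iff_of_isExpr {χ : Spectrum P} {S : Finset (Idem P × Finset (Idem P))}
    (hS : IsExpr S) : Ext χ (exprSet S) ↔ exprVal χ S := by
  constructor
  · rintro h
    by_contra hn
    have := Filter.inter_mem (ext_iff.1 h).2 (compl_mem_filt hn)
    rw [inter_compl_self] at this
    exact empty_notMem_filt χ this
  · exact fun h => ⟨S, hS, rfl, h⟩

theorem ext_idem {χ : Spectrum P} {e : Idem P} : Ext χ (e : Set P) ↔ χ e = true := by
  rw [ext_iff, idem_mem_filt]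
  exact and_iff_right (bool_idem e)

theorem filt_or_compl (χ : Spectrum P) {X : Set P} (hX : X ∈ boolClosure P) :
    X ∈ filt χ ∨ Xᶜ ∈ filt χ := by
  obtain ⟨S, _, rfl⟩ := hX
  by_cases h : exprVal χ S
  · exact Or.inl (exprVal_mem_filt h)
  · exact Or.inr (compl_mem_filt h)

theorem filt_biUnion (χ : Spectrum P) {ι : Type} (S : Finset ι) (X : ι → Set P)
    (hX : ∀ i ∈ S, X i ∈ boolClosure P) : (⋃ i ∈ S, X i) ∈ filt χ ↔ ∃ i ∈ S, X i ∈ filt χ := by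
  constructor
  · intro h
    by_contra hn
    push Not at hn
    have h1 : (⋃ i ∈ S, X i)ᶜ ∈ filt χ := by
      rw [compl_iUnion₂]
      exact (Filter.biInter_finset_mem S).2 fun i hi =>
        (filt_or_compl χ (hX i hi)).resolve_left (hn i hi)
    have := Filter.inter_mem h h1
    rw [inter_compl_self] at this
    exact empty_notMem_filt χ this
  · rintro ⟨i, hi, h⟩
    exact Filter.mem_of_superset h (subset_biUnion_of_mem (s := (S : Set ι)) hi)

/-! ### The action on the spectrum -/

/-- The character `s • χ`, given by `(s • χ) e = χ (s⁻¹ e s)`. It is defined if `χ (s⁻¹ s) = 1`. -/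
def act (s : P ≃. P) (hs : s ∈ hull P) (χ : Spectrum P) (h : Ext χ (dom s)) : Spectrum P :=
  by
    have key : ∀ e : Idem P, Ext χ (pre s (e : Set P)) ↔ pre s (e : Set P) ∈ filt χ := fun e => by
      rw [ext_iff]
      exact and_iff_right (hull_pre hs (bool_idem e))
    refine ⟨fun e => decide (Ext χ (pre s (e : Set P))), ⟨Idem.top, ?_⟩, ?_, ?_⟩
    · rw [decide_eq_true_iff]
      change Ext χ (pre s univ)
      rwa [← dom_eq_pre_univ]
    · intro e f
      rw [Bool.eq_iff_iff, Bool.and_eq_true, decide_eq_true_iff, decide_eq_true_iff,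
        decide_eq_true_iff, key, key, key]
      change pre s ((e : Set P) ∩ f) ∈ filt χ ↔ _
      rw [pre_inter, Filter.inter_mem_iff]
    · intro f F hF
      have h1 : ∀ G : Finset (Idem P), (G.sup fun e => decide (Ext χ (pre s (e : Set P)))) = true ↔
          ∃ e ∈ G, pre s (e : Set P) ∈ filt χ := by
        intro G
        induction G using Finset.induction_on with
        | empty => simp
        | insert a G ha ih => 
          rw [Finset.sup_insert, Finset.exists_mem_insert, ← ih, ← key,
            ← decide_eq_true_iff (p := Ext χ (pre s (a : Set P)))]
          generalize decide (Ext χ (pre s (a : Set P))) = u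
          generalize (G.sup fun e => decide (Ext χ (pre s (e : Set P)))) = v
          cases u <;> cases v <;> simp
      rw [Bool.eq_iff_iff, h1, decide_eq_true_iff, key, hF, pre_biUnion]
      exact filt_biUnion χ F _ fun e _ => hull_pre hs (bool_idem e)

theorem act_apply {s : P ≃. P} {hs : s ∈ hull P} {χ : Spectrum P} {h : Ext χ (dom s)}
    {e : Idem P} : act s hs χ h e = true ↔ pre s (e : Set P) ∈ filt χ := by
  change decide (Ext χ (pre s (e : Set P))) = true ↔ _
  rw [decide_eq_true_iff, ext_iff]
  exact and_iff_right (hull_pre hs (bool_idem e))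

theorem spec_ext {χ ψ : Spectrum P} (h : ∀ e : Idem P, χ e = true ↔ ψ e = true) : χ = ψ :=
  by
  obtain ⟨f, _, _, _⟩ := χ
  obtain ⟨g, _, _, _⟩ := ψ
  have : f = g := funext fun e => Bool.eq_iff_iff.2 (h e)
  subst this
  rfl

theorem ext_act {s : P ≃. P} {hs : s ∈ hull P} {χ : Spectrum P} {h : Ext χ (dom s)}
    {X : Set P} (hX : X ∈ boolClosure P) : Ext (act s hs χ h) X ↔ Ext χ (pre s X) := by
  have fwd : ∀ Y : Set P, Y ∈ filt (act s hs χ h) → pre s Y ∈ filt χ := by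
    rintro Y ⟨e, F, h1, h2, h3⟩
    refine Filter.mem_of_superset ?_ (pre_mono s h3)
    rw [pre_diff, pre_biUnion, sdiff_eq, compl_iUnion₂]
    refine Filter.inter_mem (act_apply.1 h1) ((Filter.biInter_finset_mem F).2 fun f hf => ?_)
    refine (filt_or_compl χ (hull_pre hs (bool_idem f))).resolve_left fun hc => ?_
    have := act_apply (hs := hs) (h := h).2 hc
    rw [h2 f hf] at this
    exact Bool.false_ne_true this
  rw [ext_iff, ext_iff, and_iff_right hX, and_iff_right (hull_pre hs hX)]
  refine ⟨fwd X, fun h1 => ?_⟩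
  refine (filt_or_compl _ hX).resolve_right fun hc => ?_
  have := Filter.inter_mem h1 (fwd _ hc)
  rw [← pre_inter, inter_compl_self] at this
  refine empty_notMem_filt χ (Filter.mem_of_superset this ?_)
  rintro x ⟨y, _, hy⟩
  exact hy

/-! ### The transformation groupoid -/

variable (P) in
/-- The pairs `(s, χ)` with `s` in the enlarged left inverse hull and `χ (s⁻¹ s) = 1`. -/
structure Pair where
  s : P ≃. P
  s_mem : s ∈ hull P
  χ : Spectrum P
  ext_dom : Ext χ (dom s)

/-- Two pairs `(s, χ)` and `(t, ψ)` are equivalent if `χ = ψ` and there is an idempotent `e` of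
the enlarged left inverse hull with `χ e = 1` and `s e = t e`. -/
def Pair.Rel (a b : Pair P) : Prop :=
  a.χ = b.χ ∧ ∃ e ∈ boolClosure P, Ext a.χ e ∧ restr a.s e = restr b.s e

theorem ext_inter {χ : Spectrum P} {X Y : Set P} (hX : Ext χ X) (hY : Ext χ Y) :
    Ext χ (X ∩ Y) := by
  rw [ext_iff] at *
  exact ⟨bool_inter hX.1 hY.1, Filter.inter_mem hX.2 hY.2⟩

instance Pair.setoid : Setoid (Pair P) where
  r := Pair.Rel
  iseqv := {
    refl := fun a => ⟨rfl, dom a.s, hull_dom a.s_mem, a.ext_dom, rfl⟩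
    symm := by
      rintro a b ⟨h, e, he, h1, h2⟩
      exact ⟨h.symm, e, he, h ▸ h1, h2.symm⟩
    trans := by
      rintro a b c ⟨h, e, he, h1, h2⟩ ⟨h', e', he', h1', h2'⟩
      refine ⟨h.trans h', e ∩ e', bool_inter he he', ext_inter h1 (h.symm ▸ h1'), ?_⟩
      rw [restr_eq_iff] at *
      intro x hx y
      exact (h2 x hx.1 y).trans (h2' x hx.2 y) }

variable (P) in
/-- The set of arrows of the transformation groupoid of `P`: equivalence classes `[s, χ]`. -/
def TransGpd : Type := Quotient (Pair.setoid (P := P))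

/-- The class `[s, χ]`. -/
def TransGpd.mk (a : Pair P) : TransGpd P := Quotient.mk _ a

/-- The topology on the arrows: a basis is formed by the sets `[s, U]`, where `U` is an open set of
characters `χ` with `χ (s⁻¹ s) = 1`. -/
instance : TopologicalSpace (TransGpd P) :=
  TopologicalSpace.generateFrom {V | ∃ s ∈ hull P, ∃ U : Set (Spectrum P),
    IsOpen U ∧ (∀ χ ∈ U, Ext χ (dom s)) ∧
    V = {g | ∃ a : Pair P, a.s = s ∧ a.χ ∈ U ∧ g = TransGpd.mk a}}

/-- The range character `s • χ` of a pair. -/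
def Pair.target (a : Pair P) : Spectrum P := act a.s a.s_mem a.χ a.ext_dom

theorem Pair.target_eq {a b : Pair P} (h : Pair.Rel a b) : a.target = b.target := by
  obtain ⟨h0, X, hX, h1, h2⟩ := h
  refine spec_ext fun e => ?_
  unfold Pair.target
  rw [act_apply, act_apply, ← h0]
  have h3 := (ext_iff.1 h1).2
  have h4 : X ∩ pre a.s (e : Set P) = X ∩ pre b.s (e : Set P) := by
    rw [← pre_restr, ← pre_restr, h2]
  constructor
  · intro h
    have := Filter.inter_mem h3 h
    rw [h4] at this
    exact Filter.mem_of_superset this inter_subset_right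
  · intro h
    have := Filter.inter_mem h3 h
    rw [← h4] at this
    exact Filter.mem_of_superset this inter_subset_right

/-- The source map `[s, χ] ↦ χ`. -/
def TransGpd.source (g : TransGpd P) : Spectrum P :=
  Quotient.lift Pair.χ (fun _ _ h => And.left h) g

/-- The target map `[s, χ] ↦ s • χ`. -/
def TransGpd.target (g : TransGpd P) : Spectrum P :=
  Quotient.lift Pair.target (fun _ _ h => Pair.target_eq h) g

theorem idOn_ext_dom (χ : Spectrum P) : Ext χ (dom (idOn (univ : Set P))) := by
  rw [dom_idOn]
  exact ext_idem (e := Idem.top).2 (spec_top χ)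

/-- The unit `[1, χ]`. -/
def Pair.one (χ : Spectrum P) : Pair P := ⟨idOn univ, hull_idOn bool_univ, χ, idOn_ext_dom χ⟩

theorem Pair.one_target (χ : Spectrum P) : (Pair.one χ).target = χ := by
  refine spec_ext fun e => ?_
  unfold Pair.target Pair.one
  rw [act_apply, pre_idOn, univ_inter, idem_mem_filt]

/-- The representative `(s⁻¹, s • χ)` of the inverse of `[s, χ]`. -/
def Pair.inv (a : Pair P) : Pair P :=
  ⟨a.s.symm, hull_inv a.s_mem, a.target, by
    unfold Pair.target
    rw [ext_act (hull_dom (hull_inv a.s_mem)), dom_eq_pre_univ a.s.symm, pre_symm_pre, inter_univ]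
    exact a.ext_dom⟩

theorem Pair.inv_target (a : Pair P) : a.inv.target = a.χ := by
  refine spec_ext fun e => ?_
  have h0 : a.inv.target e = true ↔ pre a.s.symm (e : Set P) ∈ filt a.target := act_apply
  have h1 : pre a.s.symm (e : Set P) ∈ boolClosure P :=
    hull_pre (hull_inv a.s_mem) (bool_idem e)
  rw [h0]
  have h2 := ext_act (hs := a.s_mem) (h := a.ext_dom) h1
  rw [pre_symm_pre, ext_iff, ext_iff, and_iff_right h1,
    and_iff_right (bool_inter (hull_dom a.s_mem) (bool_idem e)), Filter.inter_mem_iff,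
    and_iff_right (ext_iff.1 a.ext_dom).2, idem_mem_filt] at h2
  exact h2

/-- The representative `(s t, χ)` of the product of `[s, t • χ]` and `[t, χ]`. -/
def Pair.mul (a b : Pair P) (h : a.χ = b.target) : Pair P :=
  ⟨b.s.trans a.s, hull_comp a.s_mem b.s_mem, b.χ, by
    have h1 := a.ext_dom
    rw [h] at h1
    unfold Pair.target at h1
    rw [ext_act (hull_dom a.s_mem)] at h1
    rw [dom_eq_pre_univ, pre_trans, ← dom_eq_pre_univ]
    exact h1⟩

theorem Pair.mul_target (a b : Pair P) (h : a.χ = b.target) : (a.mul b h).target = a.target := by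
  refine spec_ext fun e => ?_
  have h0 : (a.mul b h).target e = true ↔ pre (b.s.trans a.s) (e : Set P) ∈ filt b.χ := act_apply
  have h1 : a.target e = true ↔ pre a.s (e : Set P) ∈ filt a.χ := act_apply
  have h2 : pre a.s (e : Set P) ∈ boolClosure P := hull_pre a.s_mem (bool_idem e)
  have h3 := ext_act (hs := b.s_mem) (h := b.ext_dom) h2
  rw [ext_iff, ext_iff, and_iff_right h2, and_iff_right (hull_pre b.s_mem h2)] at h3
  rw [h0, h1, pre_trans, h, ← h3]
  rfl

theorem Pair.inv_rel {a b : Pair P} (h : Pair.Rel a b) : Pair.Rel a.inv b.inv := by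
  have ht := Pair.target_eq h
  obtain ⟨h0, X, hX, h1, h2⟩ := h
  have hb : pre a.s.symm X ∈ boolClosure P := hull_pre (hull_inv a.s_mem) hX
  refine ⟨ht, pre a.s.symm X, hb, ?_, ?_⟩
  · change Ext (act a.s a.s_mem a.χ a.ext_dom) _
    rw [ext_act hb, pre_symm_pre]
    exact ext_inter a.ext_dom h1
  · change restr a.s.symm _ = restr b.s.symm _
    rw [restr_eq_iff] at h2 ⊢
    rintro x ⟨z, hz, hzX⟩ y
    rw [PEquiv.mem_iff_mem] at hz
    have hz' := (h2 z hzX x).1 hz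
    rw [PEquiv.mem_iff_mem, PEquiv.mem_iff_mem]
    constructor
    · intro hy
      obtain rfl := PEquiv.inj a.s hy hz
      exact hz'
    · intro hy
      obtain rfl := PEquiv.inj b.s hy hz'
      exact hz

theorem Pair.mul_rel {a b a' b' : Pair P} (h : a.χ = b.target) (h' : a'.χ = b'.target)
    (ha : Pair.Rel a a') (hb : Pair.Rel b b') : Pair.Rel (a.mul b h) (a'.mul b' h') := by
  obtain ⟨_, X, hX, hX1, hX2⟩ := ha
  obtain ⟨hχ, Y, hY, hY1, hY2⟩ := hb
  refine ⟨hχ, Y ∩ pre b.s X, bool_inter hY (hull_pre b.s_mem hX), ?_, ?_⟩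
  · refine ext_inter hY1 ?_
    rw [h] at hX1
    unfold Pair.target at hX1
    rwa [ext_act hX] at hX1
  · change restr (b.s.trans a.s) _ = restr (b'.s.trans a'.s) _
    rw [restr_eq_iff] at hX2 hY2 ⊢
    rintro x ⟨hxY, z, hz, hzX⟩ y
    rw [PEquiv.mem_trans, PEquiv.mem_trans]
    have hz' := (hY2 x hxY z).1 hz
    constructor
    · rintro ⟨w, hw, hy⟩
      obtain rfl := mem_uniq hz hw
      exact ⟨z, hz', (hX2 z hzX y).1 hy⟩
    · rintro ⟨w, hw, hy⟩
      obtain rfl := mem_uniq hz' hw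
      exact ⟨z, hz, (hX2 z hzX y).2 hy⟩

/-- The unit at `χ`. -/
def TransGpd.one (χ : Spectrum P) : TransGpd P := TransGpd.mk (Pair.one χ)

/-- The inverse `[s, χ]⁻¹ = [s⁻¹, s • χ]`. -/
def TransGpd.inv (g : TransGpd P) : TransGpd P :=
  Quotient.map Pair.inv (fun _ _ h => Pair.inv_rel h) g

theorem TransGpd.out_source (g : TransGpd P) : (Quotient.out g).χ = g.source := by
  conv_rhs => rw [← Quotient.out_eq g]
  rfl

theorem TransGpd.out_target (g : TransGpd P) : (Quotient.out g).target = g.target := by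
  conv_rhs => rw [← Quotient.out_eq g]
  rfl

/-- The product of two composable arrows, see `TransGpd.mul_mk`. -/
def TransGpd.mul (g h : TransGpd P) (hc : g.source = h.target) : TransGpd P :=
  TransGpd.mk ((Quotient.out g).mul (Quotient.out h)
    ((g.out_source.trans hc).trans h.out_target.symm))

/-- The product of `[s, t • χ]` and `[t, χ]` is `[s t, χ]`. -/
theorem TransGpd.mul_mk (a b : Pair P) (hc : (TransGpd.mk a).source = (TransGpd.mk b).target) :
    (TransGpd.mk a).mul (TransGpd.mk b) hc = TransGpd.mk (a.mul b hc) :=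
  Quotient.sound (Pair.mul_rel _ _ (Quotient.mk_out a) (Quotient.mk_out b))

theorem TransGpd.mk_eq {a b : Pair P} (h0 : a.χ = b.χ) (h : a.s = b.s) :
    TransGpd.mk a = TransGpd.mk b := by
  obtain ⟨s, hs, χ, hχ⟩ := a
  obtain ⟨t, ht, ψ, hψ⟩ := b
  obtain rfl : s = t := h
  obtain rfl : χ = ψ := h0
  rfl

theorem TransGpd.mul_source (g h : TransGpd P) (hc : g.source = h.target) :
    (g.mul h hc).source = h.source := by
  induction g using Quotient.inductionOn with | _ a
  induction h using Quotient.inductionOn with | _ b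
  have h1 := congrArg TransGpd.source (TransGpd.mul_mk a b hc)
  exact h1

theorem TransGpd.mul_target (g h : TransGpd P) (hc : g.source = h.target) :
    (g.mul h hc).target = g.target := by
  induction g using Quotient.inductionOn with | _ a
  induction h using Quotient.inductionOn with | _ b
  have h1 := congrArg TransGpd.target (TransGpd.mul_mk a b hc)
  exact h1.trans (Pair.mul_target a b hc)

theorem TransGpd.mul_congr {g g' h h' : TransGpd P} (hg : g = g') (hh : h = h')
    (hc : g.source = h.target) (hc' : g'.source = h'.target) : g.mul h hc = g'.mul h' hc' := by
  subst hg; subst hh; rfl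

theorem TransGpd.mul_assoc (g h k : TransGpd P) (h1 : g.source = h.target)
    (h2 : h.source = k.target) :
    g.mul (h.mul k h2) (h1.trans (TransGpd.mul_target h k h2).symm) =
      (g.mul h h1).mul k ((TransGpd.mul_source g h h1).trans h2) := by
  induction g using Quotient.inductionOn with | _ a
  induction h using Quotient.inductionOn with | _ b
  induction k using Quotient.inductionOn with | _ c
  have h1' : a.χ = b.target := h1
  have h2' : b.χ = c.target := h2
  have h3 : a.χ = (b.mul c h2').target := h1'.trans (Pair.mul_target b c h2').symm
  refine (TransGpd.mul_congr rfl (TransGpd.mul_mk b c h2) _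
    (show (TransGpd.mk a).source = (TransGpd.mk (b.mul c h2')).target from h3)).trans ?_
  refine (TransGpd.mul_mk a (b.mul c h2') h3).trans ?_
  refine Eq.trans ?_ (TransGpd.mul_congr (TransGpd.mul_mk a b h1) rfl _
    (show (TransGpd.mk (a.mul b h1')).source = (TransGpd.mk c).target from h2')).symm
  refine Eq.trans ?_ (TransGpd.mul_mk (a.mul b h1') c h2').symm
  exact TransGpd.mk_eq rfl (PEquiv.trans_assoc c.s b.s a.s)

/-- The transformation groupoid, as a groupoid with set of objects the spectrum. -/
instance : CategoryTheory.Groupoid (Spectrum P) where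
  Hom χ ψ := {g : TransGpd P // g.source = χ ∧ g.target = ψ}
  id χ := ⟨TransGpd.one χ, rfl, Pair.one_target χ⟩
  comp f g := ⟨g.1.mul f.1 (g.2.1.trans f.2.2.symm),
    (TransGpd.mul_source _ _ _).trans f.2.1, (TransGpd.mul_target _ _ _).trans g.2.2⟩
  inv f := ⟨f.1.inv, by
    obtain ⟨f, rfl, rfl⟩ := f
    induction f using Quotient.inductionOn with | _ a
    exact ⟨rfl, Pair.inv_target a⟩⟩
  id_comp f := by
    obtain ⟨f, rfl, rfl⟩ := f
    induction f using Quotient.inductionOn with | _ a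
    refine Subtype.ext ((TransGpd.mul_mk a (Pair.one a.χ) (Pair.one_target a.χ).symm).trans ?_)
    refine TransGpd.mk_eq rfl ?_
    refine pequiv_ext fun x y => ?_
    change y ∈ restr a.s univ x ↔ _
    rw [mem_restr]
    exact and_iff_right (mem_univ x)
  comp_id f := by
    obtain ⟨f, rfl, rfl⟩ := f
    induction f using Quotient.inductionOn with | _ a
    refine Subtype.ext ((TransGpd.mul_mk (Pair.one a.target) a rfl).trans ?_)
    refine TransGpd.mk_eq rfl ?_
    refine pequiv_ext fun x y => ?_
    change y ∈ a.s.trans (idOn univ) x ↔ _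
    rw [PEquiv.mem_trans]
    constructor
    · rintro ⟨b, hb, hy⟩
      obtain ⟨rfl, _⟩ := mem_idOn.1 hy
      exact hb
    · intro hy
      exact ⟨y, hy, mem_idOn.2 ⟨rfl, mem_univ y⟩⟩
  assoc f g h := Subtype.ext (TransGpd.mul_assoc h.1 g.1 f.1
    (h.2.1.trans g.2.2.symm) (g.2.1.trans f.2.2.symm))
  inv_comp f := by
    obtain ⟨f, rfl, rfl⟩ := f
    induction f using Quotient.inductionOn with | _ a
    refine Subtype.ext ((TransGpd.mul_mk a a.inv (Pair.inv_target a).symm).trans ?_)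
    refine Quotient.sound ⟨rfl, dom a.s.symm, hull_dom (hull_inv a.s_mem), a.inv.ext_dom, ?_⟩
    change restr (a.s.symm.trans a.s) _ = restr (idOn univ) _
    rw [restr_eq_iff]
    rintro x ⟨z, hz⟩ y
    rw [PEquiv.mem_trans, mem_idOn]
    constructor
    · rintro ⟨w, hw, hy⟩
      exact ⟨mem_uniq hy ((PEquiv.mem_iff_mem a.s).1 hw), trivial⟩
    · rintro ⟨rfl, _⟩
      exact ⟨z, hz, (PEquiv.mem_iff_mem a.s).1 hz⟩
  comp_inv f := by
    obtain ⟨f, rfl, rfl⟩ := f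
    induction f using Quotient.inductionOn with | _ a
    refine Subtype.ext ((TransGpd.mul_mk a.inv a rfl).trans ?_)
    refine Quotient.sound ⟨rfl, dom a.s, hull_dom a.s_mem, a.ext_dom, ?_⟩
    change restr (a.s.trans a.s.symm) _ = restr (idOn univ) _
    rw [restr_eq_iff]
    rintro x ⟨z, hz⟩ y
    rw [PEquiv.mem_trans, mem_idOn]
    constructor
    · rintro ⟨w, hw, hy⟩
      exact ⟨PEquiv.inj a.s ((PEquiv.mem_iff_mem a.s).1 hy) hw, trivial⟩
    · rintro ⟨rfl, _⟩
      exact ⟨z, hz, (PEquiv.mem_iff_mem a.s).2 hz⟩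

end MonoidGpd

/-- The principal right ideal `p P`. -/
def principalRightIdeal {P : Type} [Mul P] (p : P) : Set P := {x | ∃ y, x = p * y}

/-- A monoid is right LCM if it is left cancellative and the intersection of any two principal
right ideals is empty or a principal right ideal. -/
def IsRightLCM (P : Type) [Monoid P] : Prop :=
  IsLeftCancelMul P ∧ ∀ p q : P, principalRightIdeal p ∩ principalRightIdeal q = ∅ ∨
    ∃ r : P, principalRightIdeal p ∩ principalRightIdeal q = principalRightIdeal r

/-- The semidirect product of the multiplicative monoid of positive integers and `ℤ/nℤ`. -/
@[ext]
structure NatSemiZMod (n : ℕ) where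
  fst : ℕ+
  snd : ZMod n

/-- The operation is `(a, k) (b, l) = (a b, k b + l)`. -/
instance (n : ℕ) : Monoid (NatSemiZMod n) where
  mul x y := ⟨x.fst * y.fst, x.snd * ((y.fst : ℕ) : ZMod n) + y.snd⟩
  one := ⟨1, 0⟩
  mul_assoc x y z := by
    apply NatSemiZMod.ext
    · exact mul_assoc x.fst y.fst z.fst
    · change (x.snd * ((y.fst : ℕ) : ZMod n) + y.snd) * ((z.fst : ℕ) : ZMod n) + z.snd =
        x.snd * (((y.fst * z.fst : ℕ+) : ℕ) : ZMod n) +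
          (y.snd * ((z.fst : ℕ) : ZMod n) + z.snd)
      push_cast
      ring
  one_mul x := by
    apply NatSemiZMod.ext
    · exact one_mul x.fst
    · change 0 * ((x.fst : ℕ) : ZMod n) + x.snd = x.snd
      ring
  mul_one x := by
    apply NatSemiZMod.ext
    · exact mul_one x.fst
    · change x.snd * (((1 : ℕ+) : ℕ) : ZMod n) + 0 = x.snd
      simp

end

/-!
In `P = ℕ^× ⋉ ℤ/nℤ` the principal right ideal of `(a, k)` is `aℕ^× × ℤ/nℤ`: it depends on `a`
only, and two such ideals intersect in the one of the least common multiple. Left multiplication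
is injective, but right multiplication by `(n, 0)` identifies `(1, 0)` and `(1, 1)`.

Whenever any two principal right ideals intersect in a principal right ideal, every element of the
left inverse hull is a fraction `q z ↦ p z` (`LeftHull.exists_frac`). Hence the left inverse hull,
its idempotents, their boolean closure and the enlarged hull are countable if `P` is, the spectrum
is second-countable, and the bisections `[s, U]`, for `U` in a countable basis, form a countable
subbasis of the groupoid (`secondCountable_of_countable_leftHull`).

The groupoid is Hausdorff as soon as the set on which two elements `s`, `t` of the enlarged hull
are defined and agree always lies in the boolean closure (`t2Space_of_agree`): arrows with
distinct sources are separated by their sources, and if `[s, χ] ≠ [t, χ]`, then `χ` vanishes on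
that set, so that `s` and `t` have different germs at all characters near `χ`. For fractions, this
set is computed from the sets `{z | p z = q z}`. In `ℕ^× ⋉ ℤ/nℤ` such a set is empty if `p`
and `q` have different first components, and otherwise it consists of the `(c, j)` with `c` a
multiple of the additive order of the difference of the second components, so that it is a
principal right ideal (`NatSemiZMod.equalizer`).
-/

noncomputable section

namespace MonoidGpd

open Set Classical

variable {P : Type} [Monoid P] [IsLeftCancelMul P]

/-! ### Fractions in the left inverse hull -/

theorem mem_leftMul {c x y : P} : y ∈ leftMul c x ↔ c * x = y := by
  change some (c * x) = some y ↔ _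
  exact Option.some_inj

/-- The partial bijection `q z ↦ p z` from `q P` onto `p P`. -/
def frac (p q : P) : P ≃. P := (leftMul q).symm.trans (leftMul p)

theorem mem_frac {p q x y : P} : y ∈ frac p q x ↔ ∃ z, q * z = x ∧ p * z = y := by
  unfold frac
  rw [PEquiv.mem_trans]
  simp only [PEquiv.mem_iff_mem, mem_leftMul]

theorem leftHull_frac (p q : P) : LeftHull P (frac p q) :=
  LeftHull.comp (LeftHull.leftMul p) (LeftHull.inv (LeftHull.leftMul q))

theorem idOn_principalRightIdeal (q : P) : idOn (principalRightIdeal q) = frac q q := by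
  refine pequiv_ext fun x y => ?_
  rw [mem_idOn, mem_frac]
  constructor
  · rintro ⟨rfl, z, hz⟩
    exact ⟨z, hz.symm, hz.symm⟩
  · rintro ⟨z, rfl, rfl⟩
    exact ⟨rfl, z, rfl⟩

theorem principalRightIdeal_mem_boolClosure (q : P) : principalRightIdeal q ∈ boolClosure P :=
  bool_idem ⟨principalRightIdeal q, by rw [idOn_principalRightIdeal]; exact leftHull_frac q q⟩

theorem empty_mem_boolClosure : (∅ : Set P) ∈ boolClosure P :=
  ⟨∅, by simp [IsExpr], by simp [exprSet]⟩

/-- If `p P ∩ q P` is principal, then the solutions of `p z = q w` are the right multiples of one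
solution. -/
theorem exists_lcm_cofactors {p q : P}
    (h : ∃ r, principalRightIdeal p ∩ principalRightIdeal q = principalRightIdeal r) :
    ∃ u v : P, ∀ z w, p * z = q * w ↔ ∃ t, z = u * t ∧ w = v * t := by
  obtain ⟨r, hr⟩ := h
  obtain ⟨⟨u, hu⟩, v, hv⟩ := hr.ge (show r ∈ principalRightIdeal r from ⟨1, (mul_one r).symm⟩)
  refine ⟨u, v, fun z w => ⟨fun hzw => ?_, ?_⟩⟩
  · obtain ⟨t, ht⟩ := hr.le ⟨⟨z, rfl⟩, w, hzw⟩
    refine ⟨t, mul_left_cancel (a := p) ?_, mul_left_cancel (a := q) ?_⟩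
    · rw [ht, ← mul_assoc, ← hu]
    · rw [← hzw, ht, ← mul_assoc, ← hv]
  · rintro ⟨t, rfl, rfl⟩
    rw [← mul_assoc, ← mul_assoc, ← hu, ← hv]

theorem LeftHull.exists_frac
    (hlcm : ∀ p q : P, ∃ r, principalRightIdeal p ∩ principalRightIdeal q = principalRightIdeal r)
    {s : P ≃. P} (hs : LeftHull P s) : ∃ p q : P, s = frac p q := by
  induction hs with
  | leftMul c =>
    refine ⟨c, 1, pequiv_ext fun x y => ?_⟩
    rw [mem_leftMul, mem_frac]
    simp
  | @comp s t _ _ ihs iht =>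
    obtain ⟨p, q, rfl⟩ := ihs
    obtain ⟨p', q', rfl⟩ := iht
    obtain ⟨u, v, huv⟩ := exists_lcm_cofactors (hlcm p' q)
    refine ⟨p * v, q' * u, pequiv_ext fun x y => ?_⟩
    rw [PEquiv.mem_trans]
    simp only [mem_frac]
    constructor
    · rintro ⟨b, ⟨z, rfl, hz⟩, w, hw, rfl⟩
      obtain ⟨t, rfl, rfl⟩ := (huv z w).1 (hz.trans hw.symm)
      exact ⟨t, mul_assoc _ _ _, mul_assoc _ _ _⟩
    · rintro ⟨t, rfl, rfl⟩
      exact ⟨p' * (u * t), ⟨u * t, (mul_assoc _ _ _).symm, rfl⟩, v * t,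
        ((huv _ _).2 ⟨t, rfl, rfl⟩).symm, (mul_assoc _ _ _).symm⟩
  | inv _ ih =>
    obtain ⟨p, q, rfl⟩ := ih
    refine ⟨q, p, pequiv_ext fun x y => ?_⟩
    rw [PEquiv.mem_iff_mem, mem_frac, mem_frac]
    simp only [and_comm]

/-! ### Agreement sets -/

/-- The set of points at which `s` and `t` are both defined and agree. -/
def agree (s t : P ≃. P) : Set P := {x | ∃ y, y ∈ s x ∧ y ∈ t x}

theorem agree_frac_mem_boolClosure
    (hlcm : ∀ p q : P, ∃ r, principalRightIdeal p ∩ principalRightIdeal q = principalRightIdeal r)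
    (heq : ∀ p q : P, {z | p * z = q * z} = ∅ ∨ ∃ m, {z | p * z = q * z} = principalRightIdeal m)
    (p q p' q' : P) : agree (frac p q) (frac p' q') ∈ boolClosure P := by
  obtain ⟨u, v, huv⟩ := exists_lcm_cofactors (hlcm q q')
  have key : agree (frac p q) (frac p' q') =
      (fun t => q * u * t) '' {t | p * u * t = p' * v * t} := by
    ext x
    simp only [agree, mem_frac, mem_ofPred_eq, mem_image]
    constructor
    · rintro ⟨y, ⟨z, rfl, rfl⟩, w, hw, hy⟩
      obtain ⟨t, rfl, rfl⟩ := (huv z w).1 hw.symm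
      exact ⟨t, by rw [mul_assoc, mul_assoc, hy], mul_assoc _ _ _⟩
    · rintro ⟨t, ht, rfl⟩
      exact ⟨_, ⟨u * t, (mul_assoc _ _ _).symm, rfl⟩, v * t,
        by rw [mul_assoc q]; exact ((huv _ _).2 ⟨t, rfl, rfl⟩).symm,
        by rw [← mul_assoc, ← ht, mul_assoc]⟩
  rw [key]
  rcases heq (p * u) (p' * v) with h | ⟨m, h⟩
  · rw [h, image_empty]
    exact empty_mem_boolClosure
  · have : (fun t => q * u * t) '' principalRightIdeal m = principalRightIdeal (q * u * m) := by
      ext x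
      constructor
      · rintro ⟨_, ⟨t, rfl⟩, rfl⟩
        exact ⟨t, (mul_assoc _ _ _).symm⟩
      · rintro ⟨t, rfl⟩
        exact ⟨m * t, ⟨t, rfl⟩, (mul_assoc _ _ _).symm⟩
    rw [h, this]
    exact principalRightIdeal_mem_boolClosure _

theorem agree_mem_boolClosure
    (hlcm : ∀ p q : P, ∃ r, principalRightIdeal p ∩ principalRightIdeal q = principalRightIdeal r)
    (heq : ∀ p q : P, {z | p * z = q * z} = ∅ ∨ ∃ m, {z | p * z = q * z} = principalRightIdeal m)
    {s t : P ≃. P} (hs : s ∈ hull P) (ht : t ∈ hull P) : agree s t ∈ boolClosure P := by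
  obtain ⟨s, X, hs, hX, -, rfl⟩ := hs
  obtain ⟨t, Y, ht, hY, -, rfl⟩ := ht
  obtain ⟨p, q, rfl⟩ := hs.exists_frac hlcm
  obtain ⟨p', q', rfl⟩ := ht.exists_frac hlcm
  have : agree (restr (frac p q) X) (restr (frac p' q') Y) =
      (X ∩ Y) ∩ agree (frac p q) (frac p' q') := by
    ext x
    simp only [agree, mem_restr, mem_ofPred_eq, mem_inter_iff]
    constructor
    · rintro ⟨y, ⟨h1, h2⟩, h3, h4⟩
      exact ⟨⟨h1, h3⟩, y, h2, h4⟩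
    · rintro ⟨⟨h1, h3⟩, y, h2, h4⟩
      exact ⟨y, ⟨h1, h2⟩, h3, h4⟩
  rw [this]
  exact bool_inter (bool_inter hX hY) (agree_frac_mem_boolClosure hlcm heq _ _ _ _)

/-! ### The topology of the spectrum -/

theorem spectrum_toFun_injective : Function.Injective (Spectrum.toFun : Spectrum P → _) :=
  fun _ _ h => spec_ext fun e => by rw [h]

theorem continuous_spectrum_apply (e : Idem P) : Continuous fun χ : Spectrum P => χ e :=
  (continuous_apply e).comp continuous_induced_dom

instance : T2Space (Spectrum P) :=
  T2Space.of_injective_continuous spectrum_toFun_injective continuous_induced_dom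

theorem isClopen_spectrum_apply (e : Idem P) (b : Bool) : IsClopen {χ : Spectrum P | χ e = b} :=
  (isClopen_discrete {b}).preimage (continuous_spectrum_apply e)

theorem isClopen_ext {X : Set P} (hX : X ∈ boolClosure P) :
    IsClopen {χ : Spectrum P | Ext χ X} := by
  obtain ⟨S, hS, rfl⟩ := hX
  have : {χ : Spectrum P | Ext χ (exprSet S)} =
      ⋃ p ∈ S, ({χ : Spectrum P | χ p.1 = true} ∩ ⋂ f ∈ p.2, {χ : Spectrum P | χ f = false}) := by
    ext χ
    simp only [mem_ofPred_eq, ext_iff_of_isExpr hS, exprVal, mem_iUnion, mem_inter_iff,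
      mem_iInter, exists_prop]
  rw [this]
  exact S.finite_toSet.isClopen_biUnion fun p _ => (isClopen_spectrum_apply p.1 true).inter
    (p.2.finite_toSet.isClopen_biInter fun f _ => isClopen_spectrum_apply f false)

/-! ### The topology of the groupoid -/

/-- The bisection `[s, U]`: the set of the arrows `[s, χ]` with `χ ∈ U`. -/
def bisection (s : P ≃. P) (U : Set (Spectrum P)) : Set (TransGpd P) :=
  {g | ∃ a : Pair P, a.s = s ∧ a.χ ∈ U ∧ g = TransGpd.mk a}

theorem isOpen_bisection {s : P ≃. P} (hs : s ∈ hull P) {U : Set (Spectrum P)} (hU : IsOpen U)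
    (h : ∀ χ ∈ U, Ext χ (dom s)) : IsOpen (bisection s U) :=
  TopologicalSpace.isOpen_generateFrom_of_mem ⟨s, hs, U, hU, h, rfl⟩

theorem continuous_source : Continuous (TransGpd.source : TransGpd P → Spectrum P) := by
  refine continuous_def.2 fun U hU => isOpen_iff_forall_mem_open.2 fun g hg => ?_
  induction g using Quotient.inductionOn with | _ a
  refine ⟨bisection a.s ({χ | Ext χ (dom a.s)} ∩ U), ?_,
    isOpen_bisection a.s_mem ((isClopen_ext (hull_dom a.s_mem)).isOpen.inter hU)
      fun χ h => h.1, a, rfl, ⟨a.ext_dom, hg⟩, rfl⟩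
  rintro _ ⟨b, -, hb, rfl⟩
  exact hb.2

/-- If the agreement set of `s` and `t` lies in the boolean closure, then `[s, χ] = [t, χ]` if and
only if `χ` takes the value `1` at this set. -/
theorem rel_iff_ext_agree {a b : Pair P} (hX : agree a.s b.s ∈ boolClosure P) (h0 : a.χ = b.χ) :
    Pair.Rel a b ↔ Ext a.χ (agree a.s b.s) := by
  constructor
  · rintro ⟨-, e, -, h1, h2⟩
    rw [restr_eq_iff] at h2
    refine ext_iff.2 ⟨hX, Filter.mem_of_superset (ext_iff.1 (ext_inter h1 a.ext_dom)).2 ?_⟩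
    rintro x ⟨hx, y, hy⟩
    exact ⟨y, hy, (h2 x hx y).1 hy⟩
  · intro h
    refine ⟨h0, _, hX, h, restr_eq_iff.2 ?_⟩
    rintro x ⟨z, hz, hz'⟩ y
    constructor
    · intro hy
      obtain rfl := mem_uniq hz hy
      exact hz'
    · intro hy
      obtain rfl := mem_uniq hz' hy
      exact hz

theorem t2Space_of_agree
    (H : ∀ s ∈ hull P, ∀ t ∈ hull P, agree s t ∈ boolClosure P) : T2Space (TransGpd P) := by
  refine ⟨fun g h hne => ?_⟩
  by_cases hs : g.source = h.source
  · induction g using Quotient.inductionOn with | _ a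
    induction h using Quotient.inductionOn with | _ b
    have hχ : a.χ = b.χ := hs
    have hX := H a.s a.s_mem b.s b.s_mem
    have hn : ¬ Ext a.χ (agree a.s b.s) := fun h =>
      hne (Quotient.sound ((rel_iff_ext_agree hX hχ).2 h))
    have hN := (isClopen_ext hX).compl.isOpen
    -- The characters that vanish at the agreement set form an open set, and `s` and `t` have
    -- different germs at each of them.
    refine ⟨bisection a.s ({χ | Ext χ (dom a.s)} ∩ {χ | Ext χ (agree a.s b.s)}ᶜ),
      bisection b.s ({χ | Ext χ (dom b.s)} ∩ {χ | Ext χ (agree a.s b.s)}ᶜ),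
      isOpen_bisection a.s_mem ((isClopen_ext (hull_dom a.s_mem)).isOpen.inter hN) fun χ h => h.1,
      isOpen_bisection b.s_mem ((isClopen_ext (hull_dom b.s_mem)).isOpen.inter hN) fun χ h => h.1,
      ⟨a, rfl, ⟨a.ext_dom, hn⟩, rfl⟩, ⟨b, rfl, ⟨b.ext_dom, hχ ▸ hn⟩, rfl⟩, ?_⟩
    refine disjoint_left.2 ?_
    rintro _ ⟨a', ha, ha', rfl⟩ ⟨b', hb, -, hab⟩
    have hr : Pair.Rel a' b' := Quotient.exact hab
    rw [← ha, ← hb] at hX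
    have := (rel_iff_ext_agree hX hr.1).1 hr
    rw [ha, hb] at this
    exact ha'.2 this
  · obtain ⟨U, V, hU, hV, hgU, hhV, hUV⟩ := t2_separation hs
    exact ⟨_, _, hU.preimage continuous_source, hV.preimage continuous_source, hgU, hhV,
      hUV.preimage _⟩

theorem countable_idem (hc : {s : P ≃. P | LeftHull P s}.Countable) : Countable (Idem P) := by
  have := hc.to_subtype
  refine Function.Injective.countable
    (f := fun e : Idem P => (⟨idOn e, e.mem_hull⟩ : {s : P ≃. P | LeftHull P s})) ?_
  intro e f h
  have h1 : idOn (e : Set P) = idOn (f : Set P) := congrArg Subtype.val h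
  exact Idem.ext (by rw [← dom_idOn (e : Set P), h1, dom_idOn])

theorem countable_hull (hc : {s : P ≃. P | LeftHull P s}.Countable) : (hull P).Countable := by
  have := countable_idem hc
  have hb : (boolClosure P).Countable :=
    (countable_range (exprSet (P := P))).mono fun X hX => hX.imp fun S hS => hS.2
  refine (hc.image2 hb restr).mono ?_
  rintro _ ⟨s, X, hs, hX, -, rfl⟩
  exact ⟨s, hs, X, hX, rfl⟩

theorem secondCountable_of_countable_leftHull (hc : {s : P ≃. P | LeftHull P s}.Countable) :
    SecondCountableTopology (TransGpd P) := by
  have := countable_idem hc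
  have : SecondCountableTopology (Spectrum P) :=
    TopologicalSpace.secondCountableTopology_induced _ _ _
  let B := TopologicalSpace.countableBasis (Spectrum P)
  have hB : TopologicalSpace.IsTopologicalBasis B :=
    TopologicalSpace.isBasis_countableBasis (Spectrum P)
  refine ⟨{V | ∃ s ∈ hull P, ∃ U ∈ B, (∀ χ ∈ U, Ext χ (dom s)) ∧ V = bisection s U}, ?_, ?_⟩
  · refine ((countable_hull hc).image2 (TopologicalSpace.countable_countableBasis _)
      bisection).mono ?_
    rintro _ ⟨s, hs, U, hU, -, rfl⟩
    exact ⟨s, hs, U, hU, rfl⟩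
  · refine le_antisymm (le_generateFrom ?_) (le_generateFrom ?_)
    · rintro _ ⟨s, hs, U, hU, h, rfl⟩
      exact isOpen_bisection hs (hB.isOpen hU) h
    · rintro _ ⟨s, hs, U, hU, h, rfl⟩
      have hunion : bisection s U = ⋃₀ {W | ∃ V ∈ B, V ⊆ U ∧ W = bisection s V} := by
        ext g
        constructor
        · rintro ⟨a, ha, haU, rfl⟩
          obtain ⟨V, hV, haV, hVU⟩ := hB.exists_subset_of_mem_open haU hU
          exact ⟨_, ⟨V, hV, hVU, rfl⟩, a, ha, haV, rfl⟩
        · rintro ⟨_, ⟨V, -, hVU, rfl⟩, a, ha, haV, rfl⟩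
          exact ⟨a, ha, hVU haV, rfl⟩
      change TopologicalSpace.GenerateOpen _ (bisection s U)
      rw [hunion]
      refine TopologicalSpace.GenerateOpen.sUnion _ ?_
      rintro _ ⟨V, hV, hVU, rfl⟩
      exact TopologicalSpace.GenerateOpen.basic _ ⟨s, hs, V, hV, fun χ hχ => h χ (hVU hχ), rfl⟩

theorem countable_leftHull [Countable P]
    (hlcm : ∀ p q : P, ∃ r, principalRightIdeal p ∩ principalRightIdeal q =
      principalRightIdeal r) : {s : P ≃. P | LeftHull P s}.Countable := by
  refine (countable_range fun x : P × P => frac x.1 x.2).mono fun s hs => ?_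
  obtain ⟨p, q, rfl⟩ := LeftHull.exists_frac hlcm hs
  exact ⟨(p, q), rfl⟩

end MonoidGpd

/-! ### The semidirect product of the positive integers and the integers modulo `n` -/

namespace NatSemiZMod

variable {n : ℕ}

theorem fst_mul (x y : NatSemiZMod n) : (x * y).fst = x.fst * y.fst := rfl

theorem snd_mul (x y : NatSemiZMod n) :
    (x * y).snd = x.snd * ((y.fst : ℕ) : ZMod n) + y.snd := rfl

theorem isLeftCancelMul : IsLeftCancelMul (NatSemiZMod n) := by
  refine ⟨fun x y z h => ?_⟩
  have h1 : y.fst = z.fst := mul_left_cancel (congrArg fst h)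
  have h2 : x.snd * ((y.fst : ℕ) : ZMod n) + y.snd = x.snd * ((z.fst : ℕ) : ZMod n) + z.snd :=
    congrArg snd h
  rw [h1] at h2
  exact NatSemiZMod.ext h1 (add_left_cancel h2)

theorem not_isRightCancelMul (hn : 2 ≤ n) : ¬ IsRightCancelMul (NatSemiZMod n) := by
  intro h
  have : Fact (1 < n) := ⟨hn⟩
  have h1 : (⟨1, 1⟩ : NatSemiZMod n) * ⟨⟨n, by omega⟩, 0⟩ = ⟨1, 0⟩ * ⟨⟨n, by omega⟩, 0⟩ := by
    refine NatSemiZMod.ext rfl ?_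
    simp [snd_mul]
  exact one_ne_zero (congrArg snd (mul_right_cancel h1))

theorem mem_principalRightIdeal {x y : NatSemiZMod n} :
    y ∈ principalRightIdeal x ↔ x.fst ∣ y.fst := by
  constructor
  · rintro ⟨z, rfl⟩
    exact ⟨z.fst, rfl⟩
  · rintro ⟨c, hc⟩
    refine ⟨⟨c, y.snd - x.snd * ((c : ℕ) : ZMod n)⟩, NatSemiZMod.ext hc ?_⟩
    rw [snd_mul]
    ring

theorem principalRightIdeal_inter (x y : NatSemiZMod n) :
    principalRightIdeal x ∩ principalRightIdeal y = principalRightIdeal ⟨x.fst.lcm y.fst, 0⟩ := by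
  ext z
  rw [Set.mem_inter_iff]
  simp only [mem_principalRightIdeal]
  exact ⟨fun h => PNat.lcm_dvd h.1 h.2,
    fun h => ⟨(PNat.dvd_lcm_left _ _).trans h, (PNat.dvd_lcm_right _ _).trans h⟩⟩

theorem equalizer (hn : 1 ≤ n) (x y : NatSemiZMod n) :
    {z | x * z = y * z} = ∅ ∨ ∃ m, {z | x * z = y * z} = principalRightIdeal m := by
  have : NeZero n := ⟨by omega⟩
  by_cases h : x.fst = y.fst
  · refine Or.inr ⟨⟨⟨addOrderOf (x.snd - y.snd), addOrderOf_pos _⟩, 0⟩, ?_⟩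
    ext z
    rw [mem_principalRightIdeal, PNat.dvd_iff]
    change x * z = y * z ↔ addOrderOf (x.snd - y.snd) ∣ (z.fst : ℕ)
    rw [addOrderOf_dvd_iff_nsmul_eq_zero, nsmul_eq_mul, mul_comm, sub_mul, sub_eq_zero]
    constructor
    · exact fun hz => add_right_cancel (congrArg snd hz)
    · intro hz
      refine NatSemiZMod.ext ?_ ?_
      · rw [fst_mul, fst_mul, h]
      · rw [snd_mul, snd_mul, hz]
  · refine Or.inl (Set.eq_empty_of_forall_notMem fun z hz => h ?_)
    exact mul_right_cancel (congrArg fst hz : x.fst * z.fst = y.fst * z.fst)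

theorem countable (hn : 1 ≤ n) : Countable (NatSemiZMod n) := by
  have : NeZero n := ⟨by omega⟩
  refine Function.Injective.countable (f := fun x : NatSemiZMod n => (x.fst, x.snd)) ?_
  intro x y h
  exact NatSemiZMod.ext (congrArg Prod.fst h) (congrArg Prod.snd h)

end NatSemiZMod

end

theorem mainTheorem5 (n : ℕ) (hn : 1 ≤ n) :
    IsLeftCancelMul (NatSemiZMod n) ∧
    (2 ≤ n → ¬ IsRightCancelMul (NatSemiZMod n) ∧
      ∀ (G : Type*) [Group G] (f : NatSemiZMod n →* G), ¬ Function.Injective f) ∧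
    (∀ (a b : ℕ+) (k l : ZMod n),
      principalRightIdeal (⟨a, k⟩ : NatSemiZMod n) ∩ principalRightIdeal ⟨b, l⟩ =
        principalRightIdeal ⟨PNat.lcm a b, 0⟩) ∧
    IsRightLCM (NatSemiZMod n) ∧
    ∃ _ : IsLeftCancelMul (NatSemiZMod n),
      T2Space (MonoidGpd.TransGpd (NatSemiZMod n)) ∧
      SecondCountableTopology (MonoidGpd.TransGpd (NatSemiZMod n)) := by
  have hc : IsLeftCancelMul (NatSemiZMod n) := NatSemiZMod.isLeftCancelMul
  have hlcm : ∀ p q : NatSemiZMod n,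
      ∃ r, principalRightIdeal p ∩ principalRightIdeal q = principalRightIdeal r :=
    fun p q => ⟨_, NatSemiZMod.principalRightIdeal_inter p q⟩
  have := NatSemiZMod.countable hn
  refine ⟨hc, fun h2 => ⟨NatSemiZMod.not_isRightCancelMul h2, fun G _ f hf => ?_⟩,
    fun a b k l => NatSemiZMod.principalRightIdeal_inter ⟨a, k⟩ ⟨b, l⟩,
    ⟨hc, fun p q => Or.inr (hlcm p q)⟩, hc, ?_, ?_⟩
  · exact NatSemiZMod.not_isRightCancelMul h2 ⟨fun x y z h => hf <|
      mul_right_cancel (b := f x) (by rw [← map_mul, ← map_mul]; exact congrArg f h)⟩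
  · exact MonoidGpd.t2Space_of_agree fun s hs t ht =>
      MonoidGpd.agree_mem_boolClosure hlcm (NatSemiZMod.equalizer hn) hs ht
  · exact MonoidGpd.secondCountable_of_countable_leftHull (MonoidGpd.countable_leftHull hlcm)
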